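/- Let $h>0$ and let $V$ be a real, finite signed Borel measure on $\mathbb{R}$ (which may depend on $h$). For $u\in H^1(\mathbb{R})$ (complex valued) let $u_c$ denote its continuous representative, and define the distribution $$Pu := -h^2\,\partial_x^2u+u_cV ,$$ where $u_cV$ is the complex Borel measure with density $u_c$ with respect to $V$. Put $$\mathcal D:=\{u\in H^1(\mathbb{R}) : u'\in L^\infty(\mathbb{R})\ \text{and}\ Pu\in L^2(\mathbb{R})\}.$$ Then the operator $P$ on $L^2(\mathbb{R})$ with domain $\mathcal D$ has no positive eigenvalues: for every $E>0$, there is no nonzero $u\in\mathcal D$ with $Pu=Eu$. -/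

import Mathlib

open MeasureTheory Set
open scoped ContDiff ENNReal

namespace MeasureSchrodinger

/-- The complex Hilbert space `L²(ℝ)` with respect to Lebesgue measure. -/
abbrev L2 : Type := Lp ℂ 2 (volume : Measure ℝ)

/-- Test functions: smooth compactly supported complex valued functions on the line. -/
def IsTest (φ : ℝ → ℂ) : Prop := ContDiff ℝ ∞ φ ∧ HasCompactSupport φ

/-- `v` is the distributional derivative of `u` (both locally integrable). -/
def HasWeakDeriv (u v : ℝ → ℂ) : Prop :=
  LocallyIntegrable u ∧ LocallyIntegrable v ∧
    ∀ φ : ℝ → ℂ, IsTest φ → ∫ x, u x * deriv φ x = -∫ x, v x * φ x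

section Helpers

theorem IsTest.deriv {φ : ℝ → ℂ} (h : IsTest φ) : IsTest (deriv φ) :=
  ⟨(contDiff_infty_iff_deriv.1 h.1).2, h.2.deriv⟩

theorem IsTest.integrable_mul {φ u : ℝ → ℂ} (h : IsTest φ) (hu : LocallyIntegrable u) :
    Integrable (fun x => u x * φ x) := by
  have := hu.integrable_smul_left_of_hasCompactSupport h.1.continuous h.2
  simpa [mul_comm] using this

theorem IsTest.ofReal {g : ℝ → ℝ} (hg : ContDiff ℝ ∞ g) (hs : HasCompactSupport g) :
    IsTest (fun x => (g x : ℂ)) :=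
  ⟨Complex.ofRealCLM.contDiff.comp hg, hs.comp_left (g := fun y : ℝ => (y : ℂ)) (by simp)⟩

theorem ae_eq_of_test {u v : ℝ → ℂ} (hu : LocallyIntegrable u) (hv : LocallyIntegrable v)
    (h : ∀ φ : ℝ → ℂ, IsTest φ → ∫ x, u x * φ x = ∫ x, v x * φ x) : u =ᵐ[volume] v := by
  refine ae_eq_of_integral_contDiff_smul_eq hu hv fun g hg hs => ?_
  have := h _ (IsTest.ofReal hg hs)
  simpa [mul_comm] using this

theorem L2.locallyIntegrable (u : L2) : LocallyIntegrable (u : ℝ → ℂ) :=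
  (Lp.memLp u).locallyIntegrable (by norm_num)

theorem IsTest.support_subset {φ : ℝ → ℂ} (h : IsTest φ) :
    ∃ R : ℝ, 0 < R ∧ ∀ x, x ∉ Ioo (-R) R → φ x = 0 := by
  obtain ⟨r, hr⟩ := h.2.isCompact.isBounded.subset_ball (0 : ℝ)
  refine ⟨max r 1, by positivity, fun x hx => ?_⟩
  by_contra hne
  have := hr (subset_tsupport _ hne)
  rw [Real.ball_eq_Ioo] at this
  refine hx ⟨?_, ?_⟩
  · have := this.1; have := le_max_left r 1; linarith
  · have := this.2; have := le_max_left r 1; linarith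

theorem IsTest.integral_deriv {φ : ℝ → ℂ} (h : IsTest φ) (a b : ℝ) :
    ∫ x in a..b, _root_.deriv φ x = φ b - φ a :=
  intervalIntegral.integral_deriv_eq_sub
    (fun x _ => (h.1.differentiable (by simp)).differentiableAt)
    (h.deriv.1.continuous.intervalIntegrable _ _)

/-- Integration by parts for the primitive of a locally integrable function. -/
theorem hasWeakDeriv_primitive {v : ℝ → ℂ} (hv : LocallyIntegrable v) :
    HasWeakDeriv (fun x => ∫ t in (0 : ℝ)..x, v t) v := by
  have hii : ∀ a b, IntervalIntegrable v volume a b := fun a b =>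
    (hv.integrableOn_isCompact isCompact_uIcc).intervalIntegrable
  have hc : Continuous fun x => ∫ t in (0 : ℝ)..x, v t := intervalIntegral.continuous_primitive hii 0
  refine ⟨hc.locallyIntegrable, hv, fun φ hφ => ?_⟩
  obtain ⟨R, hR, hsupp⟩ := hφ.support_subset
  have hsupp' : ∀ x, x ∉ Ioc (-R) R → deriv φ x = 0 := by
    intro x hx
    have hx' : x ∉ tsupport (deriv φ) ∨ x = -R := by
      by_cases h : x = -R
      · exact Or.inr h
      · left
        intro hxt
        have hout : ∀ᶠ y in nhds x, φ y = 0 := by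
          have : (Icc (-R) R)ᶜ ∈ nhds x := by
            refine isClosed_Icc.isOpen_compl.mem_nhds fun hm => hx ⟨lt_of_le_of_ne hm.1 (Ne.symm h), hm.2⟩
          filter_upwards [this] with y hy
          exact hsupp y fun hm => hy ⟨hm.1.le, hm.2.le⟩
        have h2 : x ∉ tsupport φ := by
          rw [notMem_tsupport_iff_eventuallyEq]; exact hout
        exact h2 (tsupport_deriv_subset hxt)
    rcases hx' with h | rfl
    · exact image_eq_zero_of_notMem_tsupport h
    · have hlim : (fun y => φ y) =ᶠ[nhdsWithin (-R) (Iic (-R))] fun _ => 0 := by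
        filter_upwards [self_mem_nhdsWithin] with y hy
        exact hsupp y fun hm => absurd hm.1 (not_lt.2 hy)
      have hd : HasDerivAt φ (deriv φ (-R)) (-R) :=
        ((hφ.1.differentiable (by simp)).differentiableAt).hasDerivAt
      have h0 : HasDerivWithinAt φ 0 (Iic (-R)) (-R) :=
        (hasDerivWithinAt_const (-R) (Iic (-R)) (0 : ℂ)).congr_of_eventuallyEq hlim
          (hsupp _ (by simp))
      exact (uniqueDiffOn_Iic (-R) (-R) (by simp)).eq_deriv _ hd.hasDerivWithinAt h0
  set μ := (volume : Measure ℝ).restrict (Ioc (-R) R) with hμ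
  have hle : -R ≤ R := by linarith
  have e1 : ∀ F : ℝ → ℂ, (∀ x, x ∉ Ioc (-R) R → F x = 0) → ∫ x, F x = ∫ x, F x ∂μ := by
    intro F hF
    rw [hμ, setIntegral_eq_integral_of_forall_compl_eq_zero hF]
  have hvμ : Integrable v μ := (hii (-R) R).1
  have hdμ : Integrable (deriv φ) μ :=
    (hφ.deriv.1.continuous.integrable_of_hasCompactSupport hφ.deriv.2).restrict
  have hK : Integrable (({p : ℝ × ℝ | p.1 ≤ p.2}).indicator fun p => v p.1 * deriv φ p.2)
      (μ.prod μ) :=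
    (hvμ.mul_prod hdμ).indicator (measurableSet_le measurable_fst measurable_snd)
  have hswap := integral_integral_swap (μ := μ) (ν := μ)
    (f := fun t x => ({p : ℝ × ℝ | p.1 ≤ p.2}).indicator (fun p => v p.1 * deriv φ p.2) (t, x)) hK
  have hL : ∀ᵐ t ∂μ, (∫ x, ({p : ℝ × ℝ | p.1 ≤ p.2}).indicator
      (fun p => v p.1 * deriv φ p.2) (t, x) ∂μ) = - (v t * φ t) := by
    filter_upwards [ae_restrict_mem measurableSet_Ioc] with t ht
    have : (fun x => ({p : ℝ × ℝ | p.1 ≤ p.2}).indicator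
      (fun p => v p.1 * deriv φ p.2) (t, x)) = (Ici t).indicator (fun x => v t * deriv φ x) := by
      ext x; simp [indicator_apply]
    rw [this, integral_indicator measurableSet_Ici, hμ, Measure.restrict_restrict measurableSet_Ici,
      integral_const_mul]
    have hset : Ici t ∩ Ioc (-R) R = Icc t R := by
      ext x; simp only [mem_inter_iff, mem_Ici, mem_Ioc, mem_Icc]
      exact ⟨fun h => ⟨h.1, h.2.2⟩, fun h => ⟨h.1, lt_of_lt_of_le ht.1 h.1, h.2⟩⟩
    rw [hset, integral_Icc_eq_integral_Ioc, ← intervalIntegral.integral_of_le ht.2,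
      hφ.integral_deriv, hsupp R (by simp)]
    ring
  have hRt : ∀ᵐ x ∂μ, (∫ t, ({p : ℝ × ℝ | p.1 ≤ p.2}).indicator
      (fun p => v p.1 * deriv φ p.2) (t, x) ∂μ) = (∫ t in (-R)..x, v t) * deriv φ x := by
    filter_upwards [ae_restrict_mem measurableSet_Ioc] with x hx
    have : (fun t => ({p : ℝ × ℝ | p.1 ≤ p.2}).indicator
      (fun p => v p.1 * deriv φ p.2) (t, x)) = (Iic x).indicator (fun t => v t * deriv φ x) := by
      ext t; simp [indicator_apply]
    rw [this, integral_indicator measurableSet_Iic, hμ, Measure.restrict_restrict measurableSet_Iic,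
      integral_mul_const]
    have hset : Iic x ∩ Ioc (-R) R = Ioc (-R) x := by
      ext t; simp only [mem_inter_iff, mem_Iic, mem_Ioc]
      exact ⟨fun h => ⟨h.2.1, h.1⟩, fun h => ⟨h.2, h.1, h.2.trans hx.2⟩⟩
    rw [hset, ← intervalIntegral.integral_of_le hx.1.le]
  rw [integral_congr_ae hL, integral_congr_ae hRt] at hswap
  have h0 : ∫ x, deriv φ x ∂μ = 0 := by
    rw [hμ, ← intervalIntegral.integral_of_le hle, hφ.integral_deriv, hsupp R (by simp),
      hsupp (-R) (by simp), sub_zero]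
  rw [e1 _ (fun x hx => by rw [hsupp' x hx, mul_zero]), e1 (fun x => v x * φ x)
    (fun x hx => by rw [hsupp x fun hm => hx (Ioo_subset_Ioc_self hm), mul_zero]),
    ← integral_neg, hswap]
  have hsplit : ∀ x, (∫ t in (0 : ℝ)..x, v t) * deriv φ x
      = (∫ t in (-R)..x, v t) * deriv φ x + (∫ t in (0 : ℝ)..(-R), v t) * deriv φ x := by
    intro x
    rw [← intervalIntegral.integral_add_adjacent_intervals (hii 0 (-R)) (hii (-R) x)]
    ring
  simp_rw [hsplit]
  rw [integral_add, integral_const_mul, h0, mul_zero, add_zero]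
  · have hcR := intervalIntegral.continuous_primitive hii (-R)
    exact ((hcR.mul hφ.deriv.1.continuous).integrable_of_hasCompactSupport
      hφ.deriv.2.mul_left).restrict
  · exact hdμ.const_mul _

/-- A test function with integral zero is the derivative of a test function. -/
theorem IsTest.exists_primitive {ψ : ℝ → ℂ} (h : IsTest ψ) (h0 : ∫ x, ψ x = 0) :
    ∃ Ψ, IsTest Ψ ∧ _root_.deriv Ψ = ψ := by
  obtain ⟨R, hR, hsupp⟩ := h.support_subset
  have hd : ∀ x, HasDerivAt (fun x => ∫ t in (-R)..x, ψ t) (ψ x) x := fun x =>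
    intervalIntegral.integral_hasDerivAt_right (h.1.continuous.intervalIntegrable _ _)
      (h.1.continuous.stronglyMeasurableAtFilter _ _) h.1.continuous.continuousAt
  have hde : _root_.deriv (fun x => ∫ t in (-R)..x, ψ t) = ψ := funext fun x => (hd x).deriv
  refine ⟨fun x => ∫ t in (-R)..x, ψ t, ⟨?_, ?_⟩, hde⟩
  · rw [contDiff_infty_iff_deriv, hde]
    exact ⟨fun x => (hd x).differentiableAt, h.1⟩
  · refine HasCompactSupport.intro (isCompact_Icc (a := -R) (b := R)) fun x hx => ?_
    by_cases hxl : x < -R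
    · rw [intervalIntegral.integral_congr (g := fun _ => 0), intervalIntegral.integral_zero]
      intro t ht
      rw [uIcc_of_ge hxl.le] at ht
      exact hsupp t fun hm => absurd hm.1 (not_lt.2 ht.2)
    · have hxr : R < x := by
        by_contra hcon
        exact hx ⟨not_lt.1 hxl, not_lt.1 hcon⟩
      rw [intervalIntegral.integral_of_le (not_lt.1 hxl),
        setIntegral_eq_integral_of_forall_compl_eq_zero, h0]
      exact fun t ht => hsupp t fun hm => ht ⟨hm.1, (hm.2.trans hxr).le⟩

/-- A locally integrable function with vanishing distributional derivative is constant. -/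
theorem ae_eq_const_of_weakDeriv_zero {f : ℝ → ℂ} (hf : LocallyIntegrable f)
    (h : ∀ φ : ℝ → ℂ, IsTest φ → ∫ x, f x * deriv φ x = 0) :
    ∃ c : ℂ, f =ᵐ[volume] fun _ => c := by
  let b : ContDiffBump (0 : ℝ) := ⟨1, 2, by norm_num, by norm_num⟩
  have hρ : IsTest fun x => ((b.normed volume x : ℝ) : ℂ) :=
    IsTest.ofReal b.contDiff_normed b.hasCompactSupport_normed
  have hρ1 : ∫ x, ((b.normed volume x : ℝ) : ℂ) = 1 := by
    rw [integral_complex_ofReal, b.integral_normed, Complex.ofReal_one]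
  refine ⟨∫ x, f x * ((b.normed volume x : ℝ) : ℂ), ae_eq_of_test hf
    (continuous_const.locallyIntegrable) fun φ hφ => ?_⟩
  have hφi : Integrable φ := hφ.1.continuous.integrable_of_hasCompactSupport hφ.2
  have hρi : Integrable fun x => ((b.normed volume x : ℝ) : ℂ) :=
    hρ.1.continuous.integrable_of_hasCompactSupport hρ.2
  have hψ : IsTest fun x => φ x - (∫ y, φ y) * ((b.normed volume x : ℝ) : ℂ) :=
    ⟨hφ.1.sub (contDiff_const.mul hρ.1), hφ.2.sub hρ.2.mul_left⟩
  obtain ⟨Ψ, hΨ, hd⟩ := hψ.exists_primitive (by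
    rw [integral_sub hφi (hρi.const_mul _), integral_const_mul, hρ1, mul_one, sub_self])
  have h1 := h Ψ hΨ
  rw [hd] at h1
  simp_rw [mul_sub, ← mul_assoc, mul_comm (f _) (∫ y, φ y), mul_assoc] at h1
  rw [integral_sub (hφ.integrable_mul hf) ((hρ.integrable_mul hf).const_mul _),
    integral_const_mul, sub_eq_zero] at h1
  rw [h1, integral_const_mul, mul_comm]

theorem HasWeakDeriv.exists_continuous {u v : ℝ → ℂ} (h : HasWeakDeriv u v) :
    ∃ f : ℝ → ℂ, Continuous f ∧ u =ᵐ[volume] f := by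
  obtain ⟨hu, hv, huv⟩ := h
  have hp := hasWeakDeriv_primitive hv
  obtain ⟨c, hc⟩ := ae_eq_const_of_weakDeriv_zero (hu.sub hp.1) fun φ hφ => by
    simp only [Pi.sub_apply, sub_mul]
    rw [integral_sub (hφ.deriv.integrable_mul hu) (hφ.deriv.integrable_mul hp.1), huv φ hφ,
      hp.2.2 φ hφ, sub_self]
  refine ⟨fun x => c + ∫ t in (0 : ℝ)..x, v t, continuous_const.add
    (intervalIntegral.continuous_primitive (fun a b =>
      (hv.integrableOn_isCompact isCompact_uIcc).intervalIntegrable) 0), ?_⟩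
  filter_upwards [hc] with x hx
  rw [← hx, Pi.sub_apply, sub_add_cancel]

theorem HasWeakDeriv.congr {u u' v v' : ℝ → ℂ} (h : HasWeakDeriv u v)
    (hu : u =ᵐ[volume] u') (hv : v =ᵐ[volume] v') : HasWeakDeriv u' v' := by
  refine ⟨h.1.congr hu, h.2.1.congr hv, fun φ hφ => ?_⟩
  have e1 : ∫ x, u x * deriv φ x = ∫ x, u' x * deriv φ x :=
    integral_congr_ae (hu.mul (ae_eq_refl (deriv φ)))
  have e2 : ∫ x, v x * φ x = ∫ x, v' x * φ x := integral_congr_ae (hv.mul (ae_eq_refl φ))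
  rw [← e1, ← e2]
  exact h.2.2 φ hφ

theorem HasWeakDeriv.add {u u' v v' : ℝ → ℂ} (h : HasWeakDeriv u v) (h' : HasWeakDeriv u' v') :
    HasWeakDeriv (u + u') (v + v') := by
  refine ⟨h.1.add h'.1, h.2.1.add h'.2.1, fun φ hφ => ?_⟩
  simp only [Pi.add_apply, add_mul]
  rw [integral_add (hφ.deriv.integrable_mul h.1) (hφ.deriv.integrable_mul h'.1),
    integral_add (hφ.integrable_mul h.2.1) (hφ.integrable_mul h'.2.1), h.2.2 φ hφ, h'.2.2 φ hφ]
  ring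

theorem HasWeakDeriv.smul {u v : ℝ → ℂ} (c : ℂ) (h : HasWeakDeriv u v) :
    HasWeakDeriv (c • u) (c • v) := by
  refine ⟨h.1.smul c, h.2.1.smul c, fun φ hφ => ?_⟩
  simp only [Pi.smul_apply, smul_eq_mul, mul_assoc]
  rw [integral_const_mul, integral_const_mul, h.2.2 φ hφ]
  ring

theorem hasWeakDeriv_zero : HasWeakDeriv 0 0 :=
  ⟨locallyIntegrable_zero, locallyIntegrable_zero, fun φ _ => by simp⟩

theorem HasWeakDeriv.unique {u v v' : ℝ → ℂ} (h : HasWeakDeriv u v) (h' : HasWeakDeriv u v') :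
    v =ᵐ[volume] v' :=
  ae_eq_of_test h.2.1 h'.2.1 fun φ hφ =>
    neg_injective ((h.2.2 φ hφ).symm.trans (h'.2.2 φ hφ))

end Helpers

noncomputable section

/-- The Sobolev space `H¹(ℝ)`: elements of `L²(ℝ)` with distributional derivative in `L²(ℝ)`. -/
def H1 : Submodule ℂ L2 where
  carrier := {u | ∃ v : L2, HasWeakDeriv u v}
  add_mem' := by
    rintro u u' ⟨v, h⟩ ⟨v', h'⟩
    exact ⟨v + v', (h.add h').congr (Lp.coeFn_add u u').symm (Lp.coeFn_add v v').symm⟩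
  zero_mem' := ⟨0, hasWeakDeriv_zero.congr (Lp.coeFn_zero ℂ 2 volume).symm
    (Lp.coeFn_zero ℂ 2 volume).symm⟩
  smul_mem' := by
    rintro c u ⟨v, h⟩
    exact ⟨c • v, (h.smul c).congr (Lp.coeFn_smul c u).symm (Lp.coeFn_smul c v).symm⟩

/-- The distributional derivative `u'` of `u ∈ H¹(ℝ)`, as an element of `L²(ℝ)`. -/
def weakDeriv (u : H1) : L2 := u.2.choose

theorem hasWeakDeriv_weakDeriv (u : H1) : HasWeakDeriv (u : L2) (weakDeriv u) := u.2.choose_spec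

theorem weakDeriv_eq {u : H1} {v : L2} (h : HasWeakDeriv (u : L2) v) : weakDeriv u = v :=
  Lp.ext ((hasWeakDeriv_weakDeriv u).unique h)

/-- The continuous representative `u_c` of `u ∈ H¹(ℝ)`. -/
def contRep (u : H1) : ℝ → ℂ := (hasWeakDeriv_weakDeriv u).exists_continuous.choose

theorem continuous_contRep (u : H1) : Continuous (contRep u) :=
  (hasWeakDeriv_weakDeriv u).exists_continuous.choose_spec.1

theorem coeFn_ae_eq_contRep (u : H1) : ((u : L2) : ℝ → ℂ) =ᵐ[volume] contRep u :=
  (hasWeakDeriv_weakDeriv u).exists_continuous.choose_spec.2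

theorem contRep_eq {u : H1} {f : ℝ → ℂ} (hf : Continuous f)
    (h : ((u : L2) : ℝ → ℂ) =ᵐ[volume] f) : contRep u = f :=
  (Continuous.ae_eq_iff_eq volume (continuous_contRep u) hf).1
    ((coeFn_ae_eq_contRep u).symm.trans h)

/-- The distribution `Pu = -h² u'' + u_c V`, as a functional of the test function `φ`:
`⟨Pu, φ⟩ = -h² ∫ u φ'' dx + ∫ u_c φ dV`. -/
def distP (h : ℝ) (V : SignedMeasure ℝ) (u : H1) (φ : ℝ → ℂ) : ℂ :=
  -(h : ℂ) ^ 2 * (∫ x, (u : L2) x * deriv (deriv φ) x) + ∫ᵛ x, contRep u x * φ x ∂<•V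

/-- The distribution `Pu` belongs to `L²(ℝ)` and is given by `g`. -/
def RepresentsP (h : ℝ) (V : SignedMeasure ℝ) (u : H1) (g : L2) : Prop :=
  ∀ φ : ℝ → ℂ, IsTest φ → distP h V u φ = ∫ x, g x * φ x

theorem RepresentsP.unique {h : ℝ} {V : SignedMeasure ℝ} {u : H1} {g g' : L2}
    (hg : RepresentsP h V u g) (hg' : RepresentsP h V u g') : g = g' :=
  Lp.ext (ae_eq_of_test (L2.locallyIntegrable g) (L2.locallyIntegrable g') fun φ hφ =>
    (hg φ hφ).symm.trans (hg' φ hφ))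

theorem weakDeriv_add (u v : H1) : weakDeriv (u + v) = weakDeriv u + weakDeriv v :=
  weakDeriv_eq (((hasWeakDeriv_weakDeriv u).add (hasWeakDeriv_weakDeriv v)).congr
    (Lp.coeFn_add (u : L2) v).symm (Lp.coeFn_add _ _).symm)

theorem weakDeriv_smul (c : ℂ) (u : H1) : weakDeriv (c • u) = c • weakDeriv u :=
  weakDeriv_eq (((hasWeakDeriv_weakDeriv u).smul c).congr
    (Lp.coeFn_smul c (u : L2)).symm (Lp.coeFn_smul _ _).symm)

theorem contRep_add (u v : H1) : contRep (u + v) = contRep u + contRep v :=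
  contRep_eq ((continuous_contRep u).add (continuous_contRep v))
    ((Lp.coeFn_add (u : L2) v).trans ((coeFn_ae_eq_contRep u).add (coeFn_ae_eq_contRep v)))

theorem contRep_smul (c : ℂ) (u : H1) : contRep (c • u) = c • contRep u :=
  contRep_eq ((continuous_contRep u).const_smul c)
    ((Lp.coeFn_smul c (u : L2)).trans ((coeFn_ae_eq_contRep u).const_smul c))

theorem integrable_signedMeasure (V : SignedMeasure ℝ) {f φ : ℝ → ℂ} (hf : Continuous f)
    (hφ : IsTest φ) : V.Integrable fun x => f x * φ x := by
  change MeasureTheory.Integrable _ V.variation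
  rw [← SignedMeasure.totalVariation_eq_variation]
  unfold SignedMeasure.totalVariation
  exact (hf.mul hφ.1.continuous).integrable_of_hasCompactSupport hφ.2.mul_left

theorem distP_add (h : ℝ) (V : SignedMeasure ℝ) (u v : H1) {φ : ℝ → ℂ} (hφ : IsTest φ) :
    distP h V (u + v) φ = distP h V u φ + distP h V v φ := by
  have e : ∫ x, ((u + v : H1) : L2) x * deriv (deriv φ) x
      = (∫ x, (u : L2) x * deriv (deriv φ) x) + ∫ x, (v : L2) x * deriv (deriv φ) x := by
    rw [← integral_add (hφ.deriv.deriv.integrable_mul (L2.locallyIntegrable _))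
      (hφ.deriv.deriv.integrable_mul (L2.locallyIntegrable _))]
    refine integral_congr_ae ?_
    filter_upwards [Lp.coeFn_add (u : L2) v] with x hx
    rw [Submodule.coe_add, hx, Pi.add_apply, add_mul]
  unfold distP
  rw [e, contRep_add]
  simp only [Pi.add_apply, add_mul]
  rw [VectorMeasure.integral_fun_add (integrable_signedMeasure V (continuous_contRep u) hφ)
    (integrable_signedMeasure V (continuous_contRep v) hφ)]
  ring

theorem signedIntegral_const_mul (V : SignedMeasure ℝ) (c : ℂ) (f : ℝ → ℂ) :
    ∫ᵛ x, c * f x ∂<•V = c * ∫ᵛ x, f x ∂<•V := by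
  rw [VectorMeasure.integral_eq_setToFun, VectorMeasure.integral_eq_setToFun]
  refine setToFun_smul (𝕜 := ℂ) _ (fun c s x => ?_) c f
  simp only [smul_eq_mul]
  change (V s) • (c * x) = c * ((V s) • x)
  rw [mul_smul_comm]

theorem distP_smul (h : ℝ) (V : SignedMeasure ℝ) (c : ℂ) (u : H1) (φ : ℝ → ℂ) :
    distP h V (c • u) φ = c * distP h V u φ := by
  have e : ∫ x, ((c • u : H1) : L2) x * deriv (deriv φ) x
      = c * ∫ x, (u : L2) x * deriv (deriv φ) x := by
    rw [← integral_const_mul]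
    refine integral_congr_ae ?_
    filter_upwards [Lp.coeFn_smul c (u : L2)] with x hx
    rw [Submodule.coe_smul, hx, Pi.smul_apply, smul_eq_mul, mul_assoc]
  unfold distP
  rw [e, contRep_smul]
  simp only [Pi.smul_apply, smul_eq_mul, mul_assoc]
  rw [signedIntegral_const_mul]
  ring

theorem RepresentsP.add {h : ℝ} {V : SignedMeasure ℝ} {u v : H1} {f g : L2}
    (hf : RepresentsP h V u f) (hg : RepresentsP h V v g) :
    RepresentsP h V (u + v) (f + g) := by
  intro φ hφ
  rw [distP_add h V u v hφ, hf φ hφ, hg φ hφ,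
    ← integral_add (hφ.integrable_mul (L2.locallyIntegrable _))
      (hφ.integrable_mul (L2.locallyIntegrable _))]
  refine integral_congr_ae ?_
  filter_upwards [Lp.coeFn_add f g] with x hx
  rw [hx, Pi.add_apply, add_mul]

theorem RepresentsP.smul {h : ℝ} {V : SignedMeasure ℝ} {u : H1} {f : L2} (c : ℂ)
    (hf : RepresentsP h V u f) : RepresentsP h V (c • u) (c • f) := by
  intro φ hφ
  rw [distP_smul, hf φ hφ, ← integral_const_mul]
  refine integral_congr_ae ?_
  filter_upwards [Lp.coeFn_smul c f] with x hx
  rw [hx, Pi.smul_apply, smul_eq_mul, mul_assoc]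

theorem weakDeriv_zero : weakDeriv 0 = 0 :=
  weakDeriv_eq (hasWeakDeriv_zero.congr (Lp.coeFn_zero ℂ 2 volume).symm
    (Lp.coeFn_zero ℂ 2 volume).symm)

theorem representsP_zero (h : ℝ) (V : SignedMeasure ℝ) : RepresentsP h V 0 0 := by
  intro φ hφ
  have e := distP_smul h V 0 0 φ
  rw [zero_smul, zero_mul] at e
  rw [e, integral_congr_ae (g := fun _ => 0), integral_zero]
  filter_upwards [Lp.coeFn_zero ℂ 2 volume] with x hx
  rw [hx, Pi.zero_apply, zero_mul]

/-- Membership in `𝒟`: `u ∈ H¹(ℝ)`, `u' ∈ L^∞(ℝ)` and `Pu ∈ L²(ℝ)`. -/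
def MemDomain (h : ℝ) (V : SignedMeasure ℝ) (u : L2) : Prop :=
  ∃ hu : u ∈ H1, MemLp (weakDeriv ⟨u, hu⟩) ∞ volume ∧ ∃ g : L2, RepresentsP h V ⟨u, hu⟩ g

theorem MemDomain.add {h : ℝ} {V : SignedMeasure ℝ} {u v : L2} (mu : MemDomain h V u)
    (mv : MemDomain h V v) : MemDomain h V (u + v) := by
  obtain ⟨hu, hu', f, hf⟩ := mu
  obtain ⟨hv, hv', g, hg⟩ := mv
  have k : (⟨u + v, H1.add_mem hu hv⟩ : H1) = ⟨u, hu⟩ + ⟨v, hv⟩ := Subtype.ext rfl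
  refine ⟨H1.add_mem hu hv, ?_, f + g, by rw [k]; exact hf.add hg⟩
  rw [k, weakDeriv_add]
  exact (memLp_congr_ae (Lp.coeFn_add _ _)).2 (hu'.add hv')

theorem MemDomain.zero (h : ℝ) (V : SignedMeasure ℝ) : MemDomain h V 0 := by
  have e : weakDeriv ⟨0, H1.zero_mem⟩ = 0 := weakDeriv_zero
  refine ⟨H1.zero_mem, ?_, 0, representsP_zero h V⟩
  rw [e]
  exact (memLp_congr_ae (Lp.coeFn_zero ℂ 2 volume)).2 MemLp.zero'

theorem MemDomain.smul {h : ℝ} {V : SignedMeasure ℝ} {u : L2} (c : ℂ) (mu : MemDomain h V u) :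
    MemDomain h V (c • u) := by
  obtain ⟨hu, hu', f, hf⟩ := mu
  have k : (⟨c • u, H1.smul_mem c hu⟩ : H1) = c • ⟨u, hu⟩ := Subtype.ext rfl
  refine ⟨H1.smul_mem c hu, ?_, c • f, by rw [k]; exact hf.smul c⟩
  rw [k, weakDeriv_smul]
  exact (memLp_congr_ae (Lp.coeFn_smul _ _)).2 (hu'.const_smul c)

/-- The domain `𝒟 = {u ∈ H¹(ℝ) : u' ∈ L^∞(ℝ) and Pu ∈ L²(ℝ)}`. -/
def domainP (h : ℝ) (V : SignedMeasure ℝ) : Submodule ℂ L2 where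
  carrier := {u | MemDomain h V u}
  add_mem' := MemDomain.add
  zero_mem' := MemDomain.zero h V
  smul_mem' := fun c _ mu => mu.smul c

/-- The element of `L²(ℝ)` that represents `Pu`, for `u ∈ 𝒟`. -/
def applyP (h : ℝ) (V : SignedMeasure ℝ) (u : domainP h V) : L2 :=
  Exists.choose (Exists.choose_spec (p := fun hu : (u : L2) ∈ H1 =>
    MemLp (weakDeriv ⟨u, hu⟩) ∞ volume ∧ ∃ g : L2, RepresentsP h V ⟨u, hu⟩ g) u.2).2

theorem domainP_le (h : ℝ) (V : SignedMeasure ℝ) : domainP h V ≤ H1 := fun _ hu => hu.1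

theorem representsP_applyP {h : ℝ} {V : SignedMeasure ℝ} (u : domainP h V) :
    RepresentsP h V ⟨u, domainP_le h V u.2⟩ (applyP h V u) :=
  Exists.choose_spec (Exists.choose_spec (p := fun hu : (u : L2) ∈ H1 =>
    MemLp (weakDeriv ⟨u, hu⟩) ∞ volume ∧ ∃ g : L2, RepresentsP h V ⟨u, hu⟩ g) u.2).2

theorem applyP_eq {h : ℝ} {V : SignedMeasure ℝ} {u : domainP h V} {g : L2}
    (r : RepresentsP h V ⟨u, domainP_le h V u.2⟩ g) : applyP h V u = g :=
  (representsP_applyP u).unique r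

/-- The Schrödinger operator `P = -h² ∂ₓ² + V` as an unbounded operator on `L²(ℝ)` with
domain `𝒟`: it maps `u ∈ 𝒟` to the element of `L²(ℝ)` representing the distribution `Pu`. -/
def opP (h : ℝ) (V : SignedMeasure ℝ) : L2 →ₗ.[ℂ] L2 where
  domain := domainP h V
  toFun :=
    { toFun := applyP h V
      map_add' := fun u v => applyP_eq (by
        have k : (⟨(u + v : domainP h V), domainP_le h V (u + v).2⟩ : H1)
            = ⟨u, domainP_le h V u.2⟩ + ⟨v, domainP_le h V v.2⟩ := Subtype.ext rfl
        rw [k]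
        exact (representsP_applyP u).add (representsP_applyP v))
      map_smul' := fun c u => applyP_eq (by
        have k : (⟨(c • u : domainP h V), domainP_le h V (c • u).2⟩ : H1)
            = c • ⟨u, domainP_le h V u.2⟩ := Subtype.ext rfl
        rw [k]
        exact (representsP_applyP u).smul c) }

end

/-- `z` is an eigenvalue of the unbounded operator `T`. -/
def IsEigenvalue (T : L2 →ₗ.[ℂ] L2) (z : ℂ) : Prop :=
  ∃ u : T.domain, (u : L2) ≠ 0 ∧ T u = z • (u : L2)

end MeasureSchrodinger

namespace MeasureSchrodinger

/-! Write `E = (h k)²` with `k > 0`. Testing the eigenvalue equation against `φ` gives `h² ∫ u η = ∫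
u_c φ dV`, where `η = φ'' + k² φ`. Such an `η` has a compactly supported `φ` once it is orthogonal
to `exp (± i k t)`. Any test function `ρ` becomes admissible on subtracting a translate by a
multiple of the period `2π/k`, and the pairing of `u ∈ L²` with the translate becomes negligible as
it moves to `+∞`.

Since `k` is real, `φ` is bounded by `2 k⁻¹ ‖ρ‖₁` independently of the translation, and it vanishes
to the left of the support of `ρ`. Hence `|∫ u ρ| ≤ 2/(h² k) ‖ρ‖₁ ∫_{[b,∞)} |u_c| d|V|`, and
concentrating `ρ` at `x` from the right gives `|u_c(x)| ≤ C ∫_{[x,∞)} |u_c| d|V|`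
(`RepresentsP.norm_contRep_le`). A Gronwall argument starting at `+∞`, valid for finite measures
with atoms (`eq_zero_of_le_integral_Ici`), forces `u_c = 0`. -/

/-! ### Gronwall's inequality from `+∞` for a finite measure -/

theorem exists_setIntegral_lt_of_antitone {μ : Measure ℝ} {f : ℝ → ℝ} (hf : Integrable f μ)
    {s : ℕ → Set ℝ} (hs : ∀ n, MeasurableSet (s n)) (ha : Antitone s) (he : ⋂ n, s n = ∅)
    {δ : ℝ} (hδ : 0 < δ) : ∃ n, ∫ x in s n, f x ∂μ < δ := by
  have h := tendsto_setIntegral_of_antitone hs ha ⟨0, hf.integrableOn⟩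
  rw [he, Measure.restrict_empty, integral_zero_measure] at h
  exact (h.eventually (gt_mem_nhds hδ)).exists

/-- A bounded nonnegative function dominated by its own tail integrals vanishes on every half line
where the constant of the resulting contraction is less than one. -/
theorem eq_zero_of_le_tail_integral {μ : Measure ℝ} [IsFiniteMeasure μ] {f : ℝ → ℝ} {C B b : ℝ}
    {s : Set ℝ} (hf0 : ∀ x, 0 ≤ f x) (hfB : ∀ x, f x ≤ B) (hC : 0 ≤ C) (hs : MeasurableSet s)
    (hfi : Integrable f μ) (hf : ∀ x, f x ≤ C * ∫ t in Ici x, f t ∂μ)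
    (hsupp : ∀ x, b ≤ x → x ∉ s → f x = 0) (hq : C * μ.real s < 1) :
    ∀ x, b ≤ x → f x = 0 := by
  set M := sSup (f '' Ici b) with hM
  have hbdd : BddAbove (f '' Ici b) := ⟨B, by rintro _ ⟨x, -, rfl⟩; exact hfB x⟩
  have hle : ∀ x, b ≤ x → f x ≤ M := fun x hx => le_csSup hbdd ⟨x, hx, rfl⟩
  have hM0 : 0 ≤ M := (hf0 b).trans (hle b le_rfl)
  have key : ∀ x, b ≤ x → f x ≤ C * (M * μ.real s) := by
    intro x hx
    refine (hf x).trans (mul_le_mul_of_nonneg_left ?_ hC)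
    calc ∫ t in Ici x, f t ∂μ ≤ ∫ t in Ici x, s.indicator (fun _ => M) t ∂μ := by
          refine setIntegral_mono_on hfi.integrableOn
            ((integrable_const M).indicator hs).integrableOn measurableSet_Ici fun t ht => ?_
          by_cases hts : t ∈ s
          · rw [indicator_of_mem hts]; exact hle t (hx.trans ht)
          · rw [indicator_of_notMem hts, hsupp t (hx.trans ht) hts]
      _ ≤ ∫ t, s.indicator (fun _ => M) t ∂μ :=
          setIntegral_le_integral ((integrable_const M).indicator hs)
            (Filter.Eventually.of_forall fun t => indicator_nonneg (fun _ _ => hM0) t)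
      _ = M * μ.real s := by
          rw [integral_indicator hs, setIntegral_const, smul_eq_mul, mul_comm]
  have hMle : M ≤ C * (M * μ.real s) :=
    csSup_le ⟨_, mem_image_of_mem f self_mem_Ici⟩ (by rintro _ ⟨x, hx, rfl⟩; exact key x hx)
  -- `M ≤ q M` with `q = C * μ.real s < 1`.
  have hM' : M ≤ 0 := by nlinarith
  exact fun x hx => le_antisymm ((hle x hx).trans hM') (hf0 x)

/-- Far to the right the tail mass is small, so the contraction kills `f` there. If `f` were not
zero, let `a` be the supremum of the points where it is nonzero. Continuity gives `f a = 0`, so an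
atom at `a` is harmless, and the contraction on a short interval `[a - 1/(n+1), a)` pushes the zero
set past `a`. -/
theorem eq_zero_of_le_integral_Ici {μ : Measure ℝ} [IsFiniteMeasure μ] {f : ℝ → ℝ} {C B : ℝ}
    (hc : Continuous f) (hf0 : ∀ x, 0 ≤ f x) (hfB : ∀ x, f x ≤ B) (hC : 0 ≤ C)
    (hf : ∀ x, f x ≤ C * ∫ t in Ici x, f t ∂μ) : ∀ x, f x = 0 := by
  have hfi : Integrable f μ := Integrable.of_bound hc.aestronglyMeasurable B
    (Filter.Eventually.of_forall fun x => by rw [Real.norm_of_nonneg (hf0 x)]; exact hfB x)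
  have hsmall : ∀ s : ℕ → Set ℝ, (∀ n, MeasurableSet (s n)) → Antitone s → ⋂ n, s n = ∅ →
      ∃ n, C * μ.real (s n) < 1 := by
    intro s hs ha he
    -- The threshold uses `C + 1` because `C` may be zero.
    obtain ⟨n, hn⟩ := exists_setIntegral_lt_of_antitone (integrable_const (1 : ℝ)) (μ := μ) hs ha he
      (δ := (C + 1)⁻¹) (by positivity)
    rw [setIntegral_const, smul_eq_mul, mul_one] at hn
    refine ⟨n, ?_⟩
    have h1 : (C + 1) * μ.real (s n) < 1 := by
      rwa [← lt_div_iff₀' (by positivity), one_div]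
    nlinarith [measureReal_nonneg (μ := μ) (s := s n)]
  have htail : ∃ b, ∀ x, b ≤ x → f x = 0 := by
    obtain ⟨n, hn⟩ := hsmall (fun n => Ici (n : ℝ)) (fun _ => measurableSet_Ici)
      (fun m n h => Ici_subset_Ici.2 (by exact_mod_cast h)) (by
        refine eq_empty_of_forall_notMem fun x hx => ?_
        obtain ⟨n, hn⟩ := exists_nat_gt x
        exact absurd (mem_iInter.1 hx n) (by simpa using hn))
    exact ⟨n, eq_zero_of_le_tail_integral hf0 hfB hC measurableSet_Ici hfi hf
      (fun x hx hxs => absurd hx hxs) hn⟩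
  by_contra! hne
  obtain ⟨x₀, hx₀⟩ := hne
  obtain ⟨b₀, hb₀⟩ := htail
  set S := {x | f x ≠ 0} with hS
  have hSb : BddAbove S := ⟨b₀, fun x hx => not_lt.1 fun h => hx (hb₀ x h.le)⟩
  set a := sSup S with ha
  have hgt : ∀ x, a < x → f x = 0 := fun x hx => by
    by_contra h
    exact absurd (le_csSup hSb h) (not_le.2 hx)
  have hge : ∀ x, a ≤ x → f x = 0 := fun x hx => by
    have hcl : IsClosed {x | f x = 0} := isClosed_eq hc continuous_const
    have : Ici a ⊆ {x | f x = 0} := by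
      rw [← closure_Ioi]
      exact hcl.closure_subset_iff.2 hgt
    exact this hx
  -- The right end must be open: these intervals shrink to the empty set, whereas closed ones would
  -- retain a possible atom at `a`.
  obtain ⟨n, hn⟩ := hsmall (fun n => Ico (a - 1 / ((n : ℝ) + 1)) a) (fun _ => measurableSet_Ico)
    (fun m n h => Ico_subset_Ico_left
      (sub_le_sub_left (Nat.one_div_le_one_div h) a)) (by
      refine eq_empty_of_forall_notMem fun x hx => ?_
      have hxa : x < a := (mem_iInter.1 hx 0).2
      obtain ⟨n, hn⟩ := exists_nat_one_div_lt (sub_pos.2 hxa)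
      have := (mem_iInter.1 hx n).1
      linarith)
  have hz := eq_zero_of_le_tail_integral hf0 hfB hC measurableSet_Ico hfi hf
    (fun x hx hxs => hge x (not_lt.1 fun h => hxs ⟨hx, h⟩)) hn
  have hle : a ≤ a - 1 / ((n : ℝ) + 1) :=
    csSup_le ⟨x₀, hx₀⟩ fun x hx => not_lt.1 fun h => hx (hz x h.le)
  have : (0 : ℝ) < 1 / ((n : ℝ) + 1) := by positivity
  linarith

/-! ### Compactly supported solutions of `φ'' + k² φ = η` -/

theorem IsTest.integrable {φ : ℝ → ℂ} (h : IsTest φ) : Integrable φ :=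
  h.1.continuous.integrable_of_hasCompactSupport h.2

theorem IsTest.comp_sub {φ : ℝ → ℂ} (h : IsTest φ) (c : ℝ) : IsTest fun x => φ (x - c) :=
  ⟨h.1.comp (contDiff_id.sub contDiff_const), by
    simpa [sub_eq_add_neg, Function.comp_def] using h.2.comp_homeomorph (Homeomorph.addRight (-c))⟩

theorem IsTest.sub {φ ψ : ℝ → ℂ} (h : IsTest φ) (h' : IsTest ψ) : IsTest fun x => φ x - ψ x :=
  ⟨h.1.sub h'.1, h.2.sub h'.2⟩

theorem IsTest.norm_le_integral_deriv {φ : ℝ → ℂ} (h : IsTest φ) (t : ℝ) :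
    ‖φ t‖ ≤ ∫ x, ‖_root_.deriv φ x‖ := by
  rw [← h.2.integral_Iic_deriv_eq (h.1.of_le (by simp)) t]
  exact (norm_integral_le_integral_norm _).trans
    (setIntegral_le_integral h.deriv.integrable.norm
      (Filter.Eventually.of_forall fun _ => norm_nonneg _))

theorem IsTest.eq_zero_of_deriv_eq_zero {φ : ℝ → ℂ} (h : IsTest φ) {t : ℝ}
    (h0 : ∀ x ≤ t, _root_.deriv φ x = 0) : φ t = 0 := by
  rw [← h.2.integral_Iic_deriv_eq (h.1.of_le (by simp)) t]
  exact setIntegral_eq_zero_of_forall_eq_zero h0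

theorem contDiff_cexp_mul (k : ℂ) : ContDiff ℝ ∞ fun t : ℝ => Complex.exp (k * t) :=
  (contDiff_const.mul Complex.ofRealCLM.contDiff).cexp

theorem hasDerivAt_cexp_mul (k : ℂ) (t : ℝ) :
    HasDerivAt (fun t : ℝ => Complex.exp (k * t)) (k * Complex.exp (k * t)) t := by
  have := ((Complex.ofRealCLM.hasDerivAt (x := t)).const_mul k).cexp
  simpa [mul_comm] using this

/-- The equation `φ'' + k² φ = η` has a compactly supported solution as soon as `η` is orthogonal
to the exponentials `exp (± i k t)`. -/
theorem IsTest.exists_solution {η : ℝ → ℂ} (hη : IsTest η) {k : ℝ} (hk : 0 < k)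
    (hp : ∫ t, Complex.exp ((k * Complex.I) * (t : ℝ)) * η t = 0)
    (hm : ∫ t, Complex.exp (-(k * Complex.I) * (t : ℝ)) * η t = 0) :
    ∃ φ, IsTest φ ∧ (∀ t, _root_.deriv (_root_.deriv φ) t + (k : ℂ) ^ 2 * φ t = η t) ∧
      (∀ t, ‖φ t‖ ≤ k⁻¹ * ∫ x, ‖η x‖) ∧
      ∀ b, (∀ x < b, η x = 0) → ∀ x < b, φ x = 0 := by
  set κ : ℂ := k * Complex.I with hκ
  have hκ0 : κ ≠ 0 := by simp [hκ, hk.ne']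
  have hκ2 : κ ^ 2 = -(k : ℂ) ^ 2 := by rw [hκ, mul_pow, Complex.I_sq]; ring
  have hκn : ‖κ‖ = k := by simp [hκ, abs_of_pos hk]
  have hn1 : ∀ t : ℝ, ‖Complex.exp (κ * t)‖ = 1 := fun t => by
    rw [hκ, mul_right_comm, ← Complex.ofReal_mul, Complex.norm_exp_ofReal_mul_I]
  have hn2 : ∀ t : ℝ, ‖Complex.exp (-κ * t)‖ = 1 := fun t => by
    have := hn1 (-t)
    rwa [Complex.ofReal_neg, mul_neg, ← neg_mul] at this
  have hmul : ∀ t : ℝ, Complex.exp (κ * t) * Complex.exp (-κ * t) = 1 := fun t => by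
    rw [← Complex.exp_add, neg_mul, add_neg_cancel, Complex.exp_zero]
  have test : ∀ c : ℂ, ∀ {f : ℝ → ℂ}, IsTest f → IsTest fun t => Complex.exp (c * t) * f t :=
    fun c f hf => ⟨(contDiff_cexp_mul c).mul hf.1, hf.2.mul_left⟩
  -- The two orthogonality conditions are exactly what makes both primitives compactly supported.
  obtain ⟨A, hA, hA'⟩ := (test (-κ) hη).exists_primitive hm
  obtain ⟨B, hB, hB'⟩ := (test κ hη).exists_primitive hp
  have dA : ∀ t : ℝ, HasDerivAt A (Complex.exp (-κ * t) * η t) t := fun t => by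
    have := ((hA.1.differentiable (by simp)) t).hasDerivAt
    rwa [hA'] at this
  have dB : ∀ t : ℝ, HasDerivAt B (Complex.exp (κ * t) * η t) t := fun t => by
    have := ((hB.1.differentiable (by simp)) t).hasDerivAt
    rwa [hB'] at this
  -- Variation of constants: this is the convolution of `η` with the causal kernel `sin (k t) / k`,
  -- `t > 0`.
  set φ : ℝ → ℂ := fun t =>
    (2 * κ)⁻¹ * (Complex.exp (κ * t) * A t - Complex.exp (-κ * t) * B t) with hφ
  have d1 : ∀ t : ℝ, HasDerivAt φ
      (2⁻¹ * (Complex.exp (κ * t) * A t + Complex.exp (-κ * t) * B t)) t := by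
    intro t
    have := ((((hasDerivAt_cexp_mul κ t).mul (dA t)).sub
      ((hasDerivAt_cexp_mul (-κ) t).mul (dB t))).const_mul (2 * κ)⁻¹)
    refine this.congr_deriv ?_
    field_simp
    ring
  have d2 : ∀ t, HasDerivAt (_root_.deriv φ) (-(k : ℂ) ^ 2 * φ t + η t) t := by
    intro t
    rw [show _root_.deriv φ = _ from funext fun t => (d1 t).deriv]
    have := ((((hasDerivAt_cexp_mul κ t).mul (dA t)).add
      ((hasDerivAt_cexp_mul (-κ) t).mul (dB t))).const_mul (2 : ℂ)⁻¹)
    refine this.congr_deriv ?_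
    rw [hφ, ← hκ2]
    dsimp only
    have := hmul t
    rw [neg_mul] at this
    field_simp
    linear_combination (2 * η t) * this
  refine ⟨φ, ⟨contDiff_const.mul ((test κ hA).1.sub (test (-κ) hB).1),
    ((test κ hA).2.sub (test (-κ) hB).2).mul_left⟩, fun t => ?_, fun t => ?_, fun b hb x hx => ?_⟩
  · rw [(d2 t).deriv]; ring
  · have bA := hA.norm_le_integral_deriv t
    have bB := hB.norm_le_integral_deriv t
    simp only [hA', norm_mul, hn2, one_mul] at bA
    simp only [hB', norm_mul, hn1, one_mul] at bB
    have : ‖φ t‖ ≤ (2 * k)⁻¹ * (‖A t‖ + ‖B t‖) := by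
      rw [hφ]
      simp only [norm_mul, norm_inv, hκn, Complex.norm_ofNat]
      gcongr
      refine (norm_sub_le _ _).trans ?_
      rw [norm_mul, norm_mul, hn1, hn2, one_mul, one_mul]
    calc ‖φ t‖ ≤ (2 * k)⁻¹ * (‖A t‖ + ‖B t‖) := this
      _ ≤ (2 * k)⁻¹ * ((∫ x, ‖η x‖) + ∫ x, ‖η x‖) := by gcongr
      _ = k⁻¹ * ∫ x, ‖η x‖ := by field_simp; ring
  -- `A` and `B` are integrals from `-∞`, so they vanish as long as `η` does.
  · have zA : A x = 0 := hA.eq_zero_of_deriv_eq_zero fun y hy => by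
      simp only [hA', hb y (hy.trans_lt hx), mul_zero]
    have zB : B x = 0 := hB.eq_zero_of_deriv_eq_zero fun y hy => by
      simp only [hB', hb y (hy.trans_lt hx), mul_zero]
    simp [hφ, zA, zB]

/-! ### Boundedness in `H¹` and decay of pairings in `L²` -/

/-- Functions in `H¹(ℝ)` are bounded. -/
theorem exists_norm_contRep_le (u : H1) : ∃ B, ∀ x, ‖contRep u x‖ ≤ B := by
  set v : ℝ → ℂ := ⇑(weakDeriv u)
  have h := hasWeakDeriv_weakDeriv u
  have hp := hasWeakDeriv_primitive h.2.1
  have hii : ∀ a b, IntervalIntegrable v volume a b := fun a b =>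
    (h.2.1.integrableOn_isCompact isCompact_uIcc).intervalIntegrable
  obtain ⟨c, hc⟩ := ae_eq_const_of_weakDeriv_zero (h.1.sub hp.1) fun φ hφ => by
    simp only [Pi.sub_apply, sub_mul]
    rw [integral_sub (hφ.deriv.integrable_mul h.1) (hφ.deriv.integrable_mul hp.1), h.2.2 φ hφ,
      hp.2.2 φ hφ, sub_self]
  have hrep : contRep u = fun x => c + ∫ t in (0 : ℝ)..x, v t := by
    refine contRep_eq (continuous_const.add (intervalIntegral.continuous_primitive hii 0)) ?_
    filter_upwards [hc] with x hx
    rw [← hx, Pi.sub_apply, sub_add_cancel]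
  have hv2 : Integrable fun x => ‖v x‖ ^ 2 :=
    (memLp_two_iff_integrable_sq_norm (Lp.memLp (weakDeriv u)).1).1 (Lp.memLp _)
  have hu2 : Integrable fun x => ‖contRep u x‖ ^ 2 := by
    refine ((memLp_two_iff_integrable_sq_norm (Lp.memLp (u : L2)).1).1 (Lp.memLp _)).congr ?_
    filter_upwards [coeFn_ae_eq_contRep u] with x hx
    rw [hx]
  -- This bounds the `L¹` norm on a unit interval by the global `L²` norm, uniformly in the
  -- interval.
  have hsq : ∀ a : ℝ, a ≤ 1 + a ^ 2 := fun a => by nlinarith [sq_nonneg (a - 1)]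
  have hunit : ∀ x (f : ℝ → ℂ), Integrable (fun x => ‖f x‖ ^ 2) →
      IntervalIntegrable f volume x (x + 1) → ∫ y in x..x + 1, ‖f y‖ ≤ 1 + ∫ y, ‖f y‖ ^ 2 := by
    intro x f hf2 hf
    have hle : x ≤ x + 1 := by linarith
    calc ∫ y in x..x + 1, ‖f y‖ ≤ ∫ y in x..x + 1, (1 + ‖f y‖ ^ 2) :=
          intervalIntegral.integral_mono_on hle hf.norm
            (intervalIntegrable_const.add hf2.intervalIntegrable) fun y _ => hsq _
      _ = 1 + ∫ y in Ioc x (x + 1), ‖f y‖ ^ 2 := by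
          rw [intervalIntegral.integral_add intervalIntegrable_const hf2.intervalIntegrable,
            intervalIntegral.integral_const, intervalIntegral.integral_of_le hle]
          simp
      _ ≤ _ := by
          gcongr 1 + ?_
          exact setIntegral_le_integral hf2 (Filter.Eventually.of_forall fun _ => by positivity)
  set Bu := 1 + ∫ y, ‖contRep u y‖ ^ 2
  set Bv := 1 + ∫ y, ‖v y‖ ^ 2
  refine ⟨Bu + Bv, fun x => ?_⟩
  have hle : x ≤ x + 1 := by linarith
  have hcont := continuous_contRep u
  have hdiff : ∀ y ∈ Icc x (x + 1), ‖contRep u x‖ ≤ ‖contRep u y‖ + Bv := by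
    intro y hy
    have e : contRep u x = contRep u y - ∫ t in x..y, v t := by
      simp only [hrep]
      rw [← intervalIntegral.integral_add_adjacent_intervals (hii 0 x) (hii x y)]
      ring
    rw [e]
    refine (norm_sub_le _ _).trans ?_
    gcongr
    refine (intervalIntegral.norm_integral_le_integral_norm hy.1).trans
      (le_trans ?_ (hunit x v hv2 (hii _ _)))
    exact intervalIntegral.integral_mono_interval le_rfl hy.1 hy.2
      (Filter.Eventually.of_forall fun _ => norm_nonneg _) (hii _ _).norm
  -- Average the pointwise bound over `y ∈ [x, x + 1]`.
  have hint := intervalIntegral.integral_mono_on (μ := volume)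
    (g := fun y => ‖contRep u y‖ + Bv) hle intervalIntegrable_const
    ((hcont.norm.add continuous_const).intervalIntegrable x (x + 1)) hdiff
  rw [intervalIntegral.integral_const, intervalIntegral.integral_add
    (hcont.norm.intervalIntegrable _ _) intervalIntegrable_const,
    intervalIntegral.integral_const] at hint
  have := hunit x (contRep u) hu2 (hcont.intervalIntegrable _ _)
  simp only [add_sub_cancel_left, one_smul] at hint
  linarith

/-- Square integrable functions have arbitrarily small pairings with far translates of a test function. -/
theorem exists_norm_integral_translate_lt {u : ℝ → ℂ} (hu : MemLp u 2 volume) {ρ : ℝ → ℂ}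
    (hρ : IsTest ρ) {T : ℝ} (hT : 0 < T) {ε : ℝ} (hε : 0 < ε) :
    ∃ n : ℕ, ‖∫ x, u x * ρ (x - n * T)‖ < ε := by
  obtain ⟨R, hR, hsupp⟩ := hρ.support_subset
  have hu2 : Integrable (fun x => ‖u x‖ ^ 2) := (memLp_two_iff_integrable_sq_norm hu.1).1 hu
  have hρ2 : Integrable (fun x => ‖ρ x‖ ^ 2) :=
    (memLp_two_iff_integrable_sq_norm hρ.1.continuous.aestronglyMeasurable).1
      (hρ.1.continuous.memLp_of_hasCompactSupport hρ.2)
  obtain ⟨Q, hQ⟩ : ∃ Q, Q = ∫ x, ‖ρ x‖ ^ 2 := ⟨_, rfl⟩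
  have hQ0 : 0 ≤ Q := hQ ▸ integral_nonneg fun _ => by positivity
  -- Weight in Young's inequality `|u ρ| ≤ δ |ρ|² + δ⁻¹ |u|²`. The first term integrates to less
  -- than `ε / 2`, and so does the second once the tail of `|u|²` is below `δ * (ε / 2)`.
  obtain ⟨δ, hδ0, hδ⟩ : ∃ δ : ℝ, 0 < δ ∧ δ * (Q + 1) = ε / 2 :=
    ⟨ε / 2 / (Q + 1), by positivity, by field_simp⟩
  obtain ⟨n, hn⟩ := exists_setIntegral_lt_of_antitone hu2 (s := fun n : ℕ => Ici (-R + n * T))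
    (fun _ => measurableSet_Ici) (fun m n h => Ici_subset_Ici.2 (by gcongr)) (by
      refine eq_empty_of_forall_notMem fun x hx => ?_
      obtain ⟨n, hn⟩ := exists_nat_gt ((x + R) / T)
      have h1 : -R + n * T ≤ x := mem_iInter.1 hx n
      rw [div_lt_iff₀ hT] at hn
      linarith) (δ := δ * (ε / 2)) (by positivity)
  refine ⟨n, ?_⟩
  have hρn : Integrable fun x => ‖ρ (x - n * T)‖ ^ 2 := hρ2.comp_sub_right (n * T)
  have hui : Integrable ((Ici (-R + n * T)).indicator fun x => ‖u x‖ ^ 2) :=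
    hu2.indicator measurableSet_Ici
  calc ‖∫ x, u x * ρ (x - n * T)‖
      ≤ ∫ x, (δ * ‖ρ (x - n * T)‖ ^ 2
          + δ⁻¹ * (Ici (-R + n * T)).indicator (fun x => ‖u x‖ ^ 2) x) := by
        refine norm_integral_le_of_norm_le ((hρn.const_mul _).add (hui.const_mul _))
          (Filter.Eventually.of_forall fun x => ?_)
        by_cases hx : -R + n * T ≤ x
        · rw [indicator_of_mem (show x ∈ Ici _ from hx), norm_mul]
          have h1 := two_mul_le_add_sq (δ * ‖ρ (x - n * T)‖) ‖u x‖
          have h2 : δ * (‖u x‖ * ‖ρ (x - n * T)‖)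
              ≤ δ * (δ * ‖ρ (x - n * T)‖ ^ 2 + δ⁻¹ * ‖u x‖ ^ 2) := by
            rw [mul_add, mul_inv_cancel_left₀ hδ0.ne']
            nlinarith [mul_nonneg hδ0.le (mul_nonneg (norm_nonneg (u x))
              (norm_nonneg (ρ (x - n * T))))]
          exact le_of_mul_le_mul_left h2 hδ0
        · rw [hsupp (x - n * T) fun h => hx (by linarith [h.1]),
            indicator_of_notMem (show x ∉ Ici _ from hx)]
          simp
    _ = δ * Q + δ⁻¹ * ∫ x in Ici (-R + n * T), ‖u x‖ ^ 2 := by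
        rw [integral_add (hρn.const_mul _) (hui.const_mul _), integral_const_mul,
          integral_const_mul, integral_indicator measurableSet_Ici, hQ,
          integral_sub_right_eq_self (fun x => ‖ρ x‖ ^ 2) (n * T)]
    _ < δ * (Q + 1) + δ⁻¹ * (δ * (ε / 2)) := by gcongr; linarith
    _ = ε := by rw [inv_mul_cancel_left₀ hδ0.ne', hδ]; ring

/-! ### From the eigenvalue equation to the tail inequality -/

instance isFiniteMeasure_variation (V : SignedMeasure ℝ) : IsFiniteMeasure V.variation := by
  rw [← SignedMeasure.totalVariation_eq_variation]
  unfold SignedMeasure.totalVariation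
  infer_instance

/-- The general bound carries the norm of the bilinear pairing as a factor; here the pairing is real
scalar multiplication on `ℂ`, of norm at most one. -/
theorem norm_signedIntegral_le (V : SignedMeasure ℝ) (f : ℝ → ℂ) :
    ‖∫ᵛ x, f x ∂<•V‖ ≤ ∫ x, ‖f x‖ ∂V.variation := by
  refine VectorMeasure.norm_integral_le_integral_norm.trans
    (mul_le_of_le_one_left (integral_nonneg fun _ => norm_nonneg _) ?_)
  refine ContinuousLinearMap.opNorm_le_bound _ zero_le_one fun x => ?_
  rw [one_mul]
  refine ContinuousLinearMap.opNorm_le_bound _ (norm_nonneg _) fun c => ?_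
  simp [mul_comm]

/-- An eigenfunction tested against `φ'' + k² φ`. -/
theorem RepresentsP.integral_mul_eq {h k : ℝ} {V : SignedMeasure ℝ} {u : H1}
    (hP : RepresentsP h V u ((((h * k) ^ 2 : ℝ) : ℂ) • (u : L2))) {φ η : ℝ → ℂ} (hφ : IsTest φ)
    (hη : ∀ t, deriv (deriv φ) t + (k : ℂ) ^ 2 * φ t = η t) :
    (h : ℂ) ^ 2 * ∫ x, (u : L2) x * η x = ∫ᵛ x, contRep u x * φ x ∂<•V := by
  have e := hP φ hφ
  have e1 : ∫ x, ((((h * k) ^ 2 : ℝ) : ℂ) • (u : L2)) x * φ x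
      = ((h * k) ^ 2 : ℂ) * ∫ x, (u : L2) x * φ x := by
    rw [← integral_const_mul]
    refine integral_congr_ae ?_
    filter_upwards [Lp.coeFn_smul (((h * k) ^ 2 : ℝ) : ℂ) (u : L2)] with x hx
    rw [hx, Pi.smul_apply, smul_eq_mul, mul_assoc]
    push_cast
    rfl
  have e2 : ∫ x, (u : L2) x * η x
      = (∫ x, (u : L2) x * deriv (deriv φ) x) + (k : ℂ) ^ 2 * ∫ x, (u : L2) x * φ x := by
    have hu := L2.locallyIntegrable (u : L2)
    rw [← integral_const_mul, ← integral_add (hφ.deriv.deriv.integrable_mul hu)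
      ((hφ.integrable_mul hu).const_mul _)]
    congr 1 with x
    rw [← hη]
    ring
  rw [e1, distP] at e
  rw [e2]
  linear_combination -e

/-- Take `η = ρ - ρ(· - n T)`, with `T` the period of `exp (± i k t)`, so that the equation for `φ`
is solvable. The factor `2` comes from `‖η‖₁ ≤ 2 ‖ρ‖₁`; the translated term costs an arbitrarily
small `ε`. -/
theorem RepresentsP.norm_integral_mul_le {h k : ℝ} (hh : 0 < h) (hk : 0 < k)
    {V : SignedMeasure ℝ} {u : H1}
    (hP : RepresentsP h V u ((((h * k) ^ 2 : ℝ) : ℂ) • (u : L2))) {ρ : ℝ → ℂ} (hρ : IsTest ρ)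
    {b : ℝ} (hb : ∀ x < b, ρ x = 0) :
    ‖∫ x, (u : L2) x * ρ x‖
      ≤ 2 / (h ^ 2 * k) * (∫ x, ‖ρ x‖) * ∫ x in Ici b, ‖contRep u x‖ ∂V.variation := by
  refine le_of_forall_pos_le_add fun ε hε => ?_
  set T := 2 * Real.pi / k with hT
  have hT0 : 0 < T := by positivity
  obtain ⟨n, hn⟩ := exists_norm_integral_translate_lt (Lp.memLp (u : L2)) hρ hT0 hε
  have hρn := hρ.comp_sub (n * T)
  have hη := hρ.sub hρn
  have hu := L2.locallyIntegrable (u : L2)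
  have hper : ∀ c : ℂ, c = k * Complex.I ∨ c = -(k * Complex.I) →
      ∫ t, Complex.exp (c * (t : ℝ)) * (ρ t - ρ (t - n * T)) = 0 := by
    intro c hc
    have hshift : ∀ t : ℝ, Complex.exp (c * t) = Complex.exp (c * (t - n * T : ℝ)) := by
      intro t
      have hkT : (k : ℂ) * T = 2 * Real.pi := by
        rw [hT]; push_cast; field_simp [show (k : ℂ) ≠ 0 by exact_mod_cast hk.ne']
      rw [Complex.exp_eq_exp_iff_exists_int]
      rcases hc with rfl | rfl
      · refine ⟨n, ?_⟩
        push_cast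
        linear_combination (n * Complex.I) * hkT
      · refine ⟨-n, ?_⟩
        push_cast
        linear_combination -(n * Complex.I) * hkT
    have hI : Integrable fun t : ℝ => Complex.exp (c * t) * ρ t :=
      IsTest.integrable ⟨(contDiff_cexp_mul c).mul hρ.1, hρ.2.mul_left⟩
    have hI' : Integrable fun t : ℝ => Complex.exp (c * t) * ρ (t - n * T) :=
      IsTest.integrable ⟨(contDiff_cexp_mul c).mul hρn.1, hρn.2.mul_left⟩
    simp_rw [mul_sub]
    rw [integral_sub hI hI', sub_eq_zero,
      ← integral_sub_right_eq_self (fun t : ℝ => Complex.exp (c * t) * ρ t) (n * T)]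
    congr 1 with t
    rw [← hshift]
  obtain ⟨φ, hφ, heq, hbound, hsupp⟩ := hη.exists_solution hk (hper _ (.inl rfl))
    (hper _ (.inr rfl))
  -- The translation is to the right, so `η` also vanishes left of `b`.
  have hφb : ∀ x < b, φ x = 0 := hsupp b fun x hx => by
    have : 0 ≤ n * T := by positivity
    rw [hb x hx, hb (x - n * T) (by linarith), sub_zero]
  have hηn : ∫ x, ‖ρ x - ρ (x - n * T)‖ ≤ 2 * ∫ x, ‖ρ x‖ := by
    calc ∫ x, ‖ρ x - ρ (x - n * T)‖ ≤ ∫ x, (‖ρ x‖ + ‖ρ (x - n * T)‖) :=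
          integral_mono hη.integrable.norm (hρ.integrable.norm.add hρn.integrable.norm)
            fun x => norm_sub_le _ _
      _ = 2 * ∫ x, ‖ρ x‖ := by
          rw [integral_add hρ.integrable.norm hρn.integrable.norm,
            integral_sub_right_eq_self (fun x => ‖ρ x‖) (n * T)]
          ring
  have hI : Integrable (fun x => contRep u x * φ x) V.variation :=
    integrable_signedMeasure V (continuous_contRep u) hφ
  have hcu : Integrable (fun x => ‖contRep u x‖) V.variation := by
    obtain ⟨B, hB⟩ := exists_norm_contRep_le u
    exact Integrable.of_bound (continuous_contRep u).norm.aestronglyMeasurable B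
      (Filter.Eventually.of_forall fun x => by simpa using hB x)
  set K := k⁻¹ * (2 * ∫ x, ‖ρ x‖) with hK
  have hV : ‖∫ᵛ x, contRep u x * φ x ∂<•V‖
      ≤ K * ∫ x in Ici b, ‖contRep u x‖ ∂V.variation := by
    refine (norm_signedIntegral_le V _).trans ?_
    rw [← integral_const_mul, ← integral_indicator measurableSet_Ici]
    refine integral_mono hI.norm ((hcu.const_mul K).indicator measurableSet_Ici) fun x => ?_
    by_cases hx : x ∈ Ici b
    · rw [indicator_of_mem hx, norm_mul, mul_comm]
      gcongr
      exact (hbound x).trans (by rw [hK]; gcongr)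
    · rw [indicator_of_notMem hx, hφb x (not_le.1 hx)]
      simp
  have heq' := hP.integral_mul_eq hφ heq
  simp_rw [mul_sub] at heq'
  rw [integral_sub (hρ.integrable_mul hu) (hρn.integrable_mul hu)] at heq'
  rw [← heq', norm_mul, norm_pow, Complex.norm_real, Real.norm_of_nonneg hh.le,
    ← le_div_iff₀' (by positivity)] at hV
  have htri := norm_le_norm_sub_add (∫ x, (u : L2) x * ρ x) (∫ x, (u : L2) x * ρ (x - n * T))
  have hc : K * (∫ x in Ici b, ‖contRep u x‖ ∂V.variation) / h ^ 2
      = 2 / (h ^ 2 * k) * (∫ x, ‖ρ x‖) * ∫ x in Ici b, ‖contRep u x‖ ∂V.variation := by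
    rw [hK]
    field_simp
  linarith

/-- Approximate the value at `x` by averages against bumps of mass one; their `L¹` norm stays equal
to one, so the constant survives the limit. -/
theorem RepresentsP.norm_contRep_le {h k : ℝ} (hh : 0 < h) (hk : 0 < k)
    {V : SignedMeasure ℝ} {u : H1}
    (hP : RepresentsP h V u ((((h * k) ^ 2 : ℝ) : ℂ) • (u : L2))) (x : ℝ) :
    ‖contRep u x‖ ≤ 2 / (h ^ 2 * k) * ∫ t in Ici x, ‖contRep u t‖ ∂V.variation := by
  refine le_of_forall_pos_le_add fun δ hδ => ?_
  obtain ⟨ε, hε, hclose⟩ := Metric.continuous_iff.1 (continuous_contRep u) x δ hδ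
  -- The bump is centred so that its support function lives in `(x, x + ε)`: lying to the right of
  -- `x` is what makes the tail start at `x` itself.
  let β : ContDiffBump (x + ε / 2) := ⟨ε / 4, ε / 2, by positivity, by linarith⟩
  set ρ : ℝ → ℂ := fun t => ((β.normed volume t : ℝ) : ℂ) with hρdef
  have hρ : IsTest ρ := IsTest.ofReal β.contDiff_normed β.hasCompactSupport_normed
  have hsupp : ∀ t, ρ t ≠ 0 → x < t ∧ t < x + ε := by
    intro t ht
    have h1 : t ∈ Function.support (β.normed volume) := fun h0 => ht (by simp [hρdef, h0])
    rw [β.support_normed_eq, Real.ball_eq_Ioo] at h1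
    have h2 : x + ε / 2 - ε / 2 < t := h1.1
    have h3 : t < x + ε / 2 + ε / 2 := h1.2
    constructor <;> linarith
  have hn : ∀ t, ‖ρ t‖ = β.normed volume t := fun t => by
    rw [hρdef, Complex.norm_real, Real.norm_of_nonneg (β.nonneg_normed t)]
  have hn1 : ∫ t, ‖ρ t‖ = 1 := by simp_rw [hn]; exact β.integral_normed
  have h1 : ∫ t, ρ t = 1 := by
    rw [hρdef, integral_complex_ofReal, β.integral_normed, Complex.ofReal_one]
  have hP' := hP.norm_integral_mul_le hh hk hρ (b := x) fun t ht => by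
    by_contra h0
    exact absurd (hsupp t h0).1 (not_lt.2 ht.le)
  rw [hn1, mul_one] at hP'
  have hloc := (continuous_contRep u).locallyIntegrable (μ := volume)
  have e : ∫ t, (u : L2) t * ρ t = ∫ t, contRep u t * ρ t :=
    integral_congr_ae ((coeFn_ae_eq_contRep u).mul (ae_eq_refl ρ))
  have hdiff : ‖contRep u x - ∫ t, contRep u t * ρ t‖ ≤ δ := by
    have e' : contRep u x - ∫ t, contRep u t * ρ t
        = ∫ t, (contRep u x - contRep u t) * ρ t := by
      simp_rw [sub_mul]
      rw [integral_sub (hρ.integrable.const_mul _) (hρ.integrable_mul hloc), integral_const_mul,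
        h1, mul_one]
    rw [e']
    refine (norm_integral_le_of_norm_le (hρ.integrable.norm.const_mul δ)
      (Filter.Eventually.of_forall fun t => ?_)).trans
        (by rw [integral_const_mul, hn1, mul_one])
    rw [norm_mul]
    by_cases h0 : ρ t = 0
    · simp [h0]
    · gcongr
      obtain ⟨ha, hb⟩ := hsupp t h0
      rw [← dist_eq_norm, dist_comm]
      exact (hclose t (by rw [Real.dist_eq, abs_of_pos (by linarith)]; linarith)).le
  rw [e] at hP'
  have := norm_le_norm_sub_add (contRep u x) (∫ t, contRep u t * ρ t)
  linarith

end MeasureSchrodinger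

/-! ### Absence of positive eigenvalues -/

open MeasureSchrodinger in
theorem corollary1p2 (h : ℝ) (hh : 0 < h) (V : MeasureTheory.SignedMeasure ℝ) :
    ∀ E : ℝ, 0 < E →
      ¬ MeasureSchrodinger.IsEigenvalue (MeasureSchrodinger.opP h V) (E : ℂ) := by
  rintro E hE ⟨u, hu0, hu⟩
  set w : H1 := ⟨u, domainP_le h V u.2⟩ with hw
  -- The wave number `k = √E / h` satisfies `(h k)² = E`.
  have hk : 0 < √E / h := by positivity
  have hP : RepresentsP h V w ((((h * (√E / h)) ^ 2 : ℝ) : ℂ) • (w : L2)) := by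
    rw [mul_div_cancel₀ _ hh.ne', Real.sq_sqrt hE.le]
    have := representsP_applyP u
    rwa [show applyP h V u = (E : ℂ) • (u : L2) from hu] at this
  obtain ⟨B, hB⟩ := exists_norm_contRep_le w
  have hz := eq_zero_of_le_integral_Ici (continuous_contRep w).norm (fun _ => norm_nonneg _) hB
    (by positivity) (hP.norm_contRep_le hh hk)
  refine hu0 (Lp.ext ?_)
  filter_upwards [coeFn_ae_eq_contRep w, Lp.coeFn_zero ℂ 2 (volume : Measure ℝ)] with x hx h0
  rw [h0, Pi.zero_apply, ← norm_eq_zero, ← hz x, ← hx]
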